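/- Let $k$ be a field, $V$ a $k$-vector space of finite dimension $n$ with basis $(x_1,\dots,x_n)$, and let $f=\sum_{i,j} f_{ij}\,x_i\otimes x_j\in V\otimes V$. Assume that $f$ has rank $1$, i.e. that its matrix of coefficients $M(f)=(f_{ij})$ has rank $1$ (so $f\neq 0$ and $n\ge 1$; the rank does not depend on the basis). Put $R=kf\subseteq V\otimes V$ and let $A=T(V)/I(R)$ be the quotient of the tensor algebra by the two-sided ideal generated by $f$, viewed as a connected graded algebra with augmentation $\varepsilon:A\to k$. Consider the property (P2) there exists a basis of $V$ relative to which all the entries of the matrix of coefficients of $f$ are zero, except one which is located on the diagonal. Then: (i) $A$ is Koszul: with $W_0=k$, $W_1=V$ and $W_m=\bigcap_{i+2+j=m}V^{\otimes i}\otimes R\otimes V^{\otimes j}\subseteq V^{\otimes m}$ for $m\ge 2$, the Koszul complex $\cdots\to A\otimes W_2\to A\otimes W_1\to A\otimes W_0\to 0$ of left $A$-modules, whose differential is the inclusion $W_{m+1}\subseteq V\otimes W_m$ followed by $a\otimes v\otimes w\mapsto av\otimes w$, has zero homology in every degree $>0$. (ii) The global dimension of $A$ (the supremum of the projective dimensions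 of left $A$-modules) is $2$ or infinite. (iii) The global dimension of $A$ is infinite if and only if (P2) holds; moreover, (P2) holds if and only if $f$ is symmetric, i.e. invariant under the exchange of the two tensor factors. (iv) $A$ is not AS-Gorenstein, where $A$ is called AS-Gorenstein if it has finite global dimension $d\ge 1$, $\mathrm{Ext}^i_A(k,A)=0$ for all $i\ne d$, and $\mathrm{Ext}^d_A(k,A)\cong k$ as right $A$-modules (Ext of left modules). -/

import Mathlib

open TensorProduct

namespace QuadAlg

universe u v

section Algebra

variable {k : Type u} [Field k] {V : Type v} [AddCommGroup V] [Module k V]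

/-- The canonical map `V ⊗ V → T(V)`, `x ⊗ y ↦ x y`, identifying `V ⊗ V` with the degree two part
of the tensor algebra. -/
noncomputable def toTensorAlgebra : V ⊗[k] V →ₗ[k] TensorAlgebra k V :=
  TensorProduct.lift
    ((LinearMap.mul k (TensorAlgebra k V)).compl₁₂ (TensorAlgebra.ι k) (TensorAlgebra.ι k))

@[simp] theorem toTensorAlgebra_tmul (x y : V) :
    toTensorAlgebra (x ⊗ₜ[k] y) = TensorAlgebra.ι k x * TensorAlgebra.ι k y := rfl

/-- The `2`-homogeneous algebra `A(V, R) = T(V) / I(R)`, where `I(R)` is the two-sided ideal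
generated by the space of relations `R ⊆ V ⊗ V`. -/
abbrev QuadraticAlgebra (R : Submodule k (V ⊗[k] V)) : Type (max u v) :=
  RingQuot (fun a b : TensorAlgebra k V => (∃ r ∈ R, toTensorAlgebra r = a) ∧ b = 0)

/-- The projection `T(V) → A(V, R)`. -/
noncomputable def proj (R : Submodule k (V ⊗[k] V)) :
    TensorAlgebra k V →ₐ[k] QuadraticAlgebra R :=
  RingQuot.mkAlgHom k _

theorem algebraMapInv_toTensorAlgebra (r : V ⊗[k] V) :
    TensorAlgebra.algebraMapInv (toTensorAlgebra r) = (0 : k) := by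
  induction r with
  | zero => simp
  | tmul x y => simp [TensorAlgebra.algebraMapInv]
  | add x y hx hy => simp [hx, hy]

/-- The augmentation `ε : A(V, R) → k`, killing the generators `V`. -/
noncomputable def augmentation (R : Submodule k (V ⊗[k] V)) : QuadraticAlgebra R →ₐ[k] k :=
  RingQuot.liftAlgHom k ⟨TensorAlgebra.algebraMapInv, by
    rintro a b ⟨⟨r, -, rfl⟩, rfl⟩
    rw [algebraMapInv_toTensorAlgebra, map_zero]⟩

theorem augmentation_proj (R : Submodule k (V ⊗[k] V)) (t : TensorAlgebra k V) :
    augmentation R (proj R t) = TensorAlgebra.algebraMapInv t := by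
  simp [augmentation, proj]

end Algebra

section Koszul

variable {k : Type u} [Field k] {V : Type v} [AddCommGroup V] [Module k V]

/-- The subspace `W_m = ⋂_{i + 2 + j = m} V^{⊗ i} ⊗ R ⊗ V^{⊗ j}` of `V^{⊗ m}`, with `V^{⊗ m}` seen as
the degree `m` part of the tensor algebra. For `m < 2` this is `V^{⊗ m}`. -/
noncomputable def W (R : Submodule k (V ⊗[k] V)) (m : ℕ) : Submodule k (TensorAlgebra k V) :=
  (TensorAlgebra.ι k (M := V)).range ^ m ⊓
    ⨅ (i : ℕ) (j : ℕ) (_ : i + 2 + j = m),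
      (TensorAlgebra.ι k (M := V)).range ^ i * R.map toTensorAlgebra *
        (TensorAlgebra.ι k (M := V)).range ^ j

/-- Auxiliary action of `v : V` on `T(V) × (V ⊗ T(V))`: `(t, s) ↦ (v t, v ⊗ t)`. -/
noncomputable def splitAct :
    V →ₗ[k] Module.End k (TensorAlgebra k V × (V ⊗[k] TensorAlgebra k V)) where
  toFun v :=
    ((LinearMap.mulLeft k (TensorAlgebra.ι k v)).prod
      (TensorProduct.mk k V (TensorAlgebra k V) v)) ∘ₗ LinearMap.fst k _ _
  map_add' v w := by
    ext <;> simp [add_mul]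
  map_smul' c v := by
    ext <;> simp

/-- The linear map `T(V) → V ⊗ T(V)` splitting off the first letter: it is characterised by
`1 ↦ 0` and `v t ↦ v ⊗ t`. -/
noncomputable def split : TensorAlgebra k V →ₗ[k] V ⊗[k] TensorAlgebra k V :=
  LinearMap.snd k _ _ ∘ₗ LinearMap.applyₗ (1, 0) ∘ₗ
    (TensorAlgebra.lift k (splitAct (k := k) (V := V))).toLinearMap

theorem lift_splitAct_fst (t : TensorAlgebra k V)
    (p : TensorAlgebra k V × (V ⊗[k] TensorAlgebra k V)) :
    (TensorAlgebra.lift k (splitAct (k := k) (V := V)) t p).1 = t * p.1 := by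
  induction t using TensorAlgebra.induction generalizing p with
  | algebraMap r => simp [Module.algebraMap_end_apply, Algebra.smul_def]
  | ι x => simp [splitAct]
  | mul a b ha hb => simp [ha, hb, mul_assoc]
  | add a b ha hb => simp [ha, hb, add_mul]

@[simp] theorem split_one : split (1 : TensorAlgebra k V) = 0 := by
  simp [split]

@[simp] theorem split_ι_mul (x : V) (t : TensorAlgebra k V) :
    split (TensorAlgebra.ι k x * t) = x ⊗ₜ[k] t := by
  have h := lift_splitAct_fst t ((1 : TensorAlgebra k V), (0 : V ⊗[k] TensorAlgebra k V))
  simp only [mul_one] at h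
  have h2 : (TensorAlgebra.lift k (splitAct (k := k) (V := V)) (TensorAlgebra.ι k x * t)
      ((1 : TensorAlgebra k V), (0 : V ⊗[k] TensorAlgebra k V))).2 =
      x ⊗ₜ[k] (TensorAlgebra.lift k (splitAct (k := k) (V := V)) t
        ((1 : TensorAlgebra k V), (0 : V ⊗[k] TensorAlgebra k V))).1 := by
    rw [map_mul, TensorAlgebra.lift_ι_apply]
    rfl
  rw [h] at h2
  exact h2

/-- `V ⊗ S` as a subspace of `V ⊗ T(V)`. -/
noncomputable def tensorSub (S : Submodule k (TensorAlgebra k V)) :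
    Submodule k (V ⊗[k] TensorAlgebra k V) :=
  (LinearMap.lTensor V S.subtype).range

theorem mem_tensorSub_iff (S : Submodule k (TensorAlgebra k V))
    (s : V ⊗[k] TensorAlgebra k V) :
    s ∈ tensorSub S ↔ ∀ φ : Module.Dual k V,
      TensorProduct.lid k _ (LinearMap.rTensor (TensorAlgebra k V) φ s) ∈ S := by
  constructor
  · rintro ⟨x, rfl⟩ φ
    induction x with
    | zero => simp
    | tmul v t => simpa using S.smul_mem _ t.2
    | add x y hx hy => simpa only [map_add] using S.add_mem hx hy
  · intro h
    let b := Module.Basis.ofVectorSpace k V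
    obtain ⟨c, rfl⟩ := TensorProduct.eq_repr_basis_left b s
    refine Submodule.sum_mem _ fun i _ => ?_
    have hi : c i ∈ S := by
      have h2 := h (b.coord i)
      simp only [Finsupp.sum, map_sum, LinearMap.rTensor_tmul, TensorProduct.lid_tmul,
        Module.Basis.coord_apply, Module.Basis.repr_self] at h2
      rw [Finset.sum_eq_single i] at h2
      · simpa using h2
      · intro j _ hj
        rw [Finsupp.single_eq_of_ne (Ne.symm hj), zero_smul]
      · intro hn
        rw [Finsupp.notMem_support_iff.1 hn, smul_zero]
    exact ⟨b i ⊗ₜ ⟨c i, hi⟩, by simp⟩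

theorem split_mem_tensorSub (S : Submodule k (TensorAlgebra k V)) {w : TensorAlgebra k V}
    (hw : w ∈ (TensorAlgebra.ι k (M := V)).range * S) : split w ∈ tensorSub S := by
  induction hw using Submodule.mul_induction_on' with
  | mem_mul_mem m hm n hn =>
    obtain ⟨x, rfl⟩ := hm
    exact ⟨x ⊗ₜ ⟨n, hn⟩, by simp⟩
  | add x _ y _ hx hy => simpa only [map_add] using (tensorSub S).add_mem hx hy

/-- `W_{i+1} ⊆ V ⊗ W_i`. -/
theorem split_mem_tensorSub_W (R : Submodule k (V ⊗[k] V)) (i : ℕ) {w : TensorAlgebra k V}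
    (hw : w ∈ W R (i + 1)) : split w ∈ tensorSub (W R i) := by
  rw [mem_tensorSub_iff]
  intro φ
  simp only [W, Submodule.mem_inf, Submodule.mem_iInf] at hw ⊢
  refine ⟨(mem_tensorSub_iff _ _).1 (split_mem_tensorSub _ ?_) φ, fun a b hab =>
    (mem_tensorSub_iff _ _).1 (split_mem_tensorSub _ ?_) φ⟩
  · rw [← pow_succ']; exact hw.1
  · have := hw.2 (a + 1) b (by omega)
    rwa [pow_succ', mul_assoc, mul_assoc, ← mul_assoc (_ ^ a)] at this

theorem lTensor_W_injective (R : Submodule k (V ⊗[k] V)) (i : ℕ) :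
    Function.Injective (LinearMap.lTensor V (W R i).subtype) :=
  Module.Flat.lTensor_preserves_injective_linearMap _ (W R i).injective_subtype

/-- The inclusion `W_{i+1} ↪ V ⊗ W_i`. -/
noncomputable def inclW (R : Submodule k (V ⊗[k] V)) (i : ℕ) :
    W R (i + 1) →ₗ[k] V ⊗[k] W R i :=
  (LinearEquiv.ofInjective _ (lTensor_W_injective R i)).symm.toLinearMap ∘ₗ
    split.restrict (fun _ hw => split_mem_tensorSub_W R i hw)

theorem lTensor_inclW (R : Submodule k (V ⊗[k] V)) (i : ℕ) (w : W R (i + 1)) :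
    LinearMap.lTensor V (W R i).subtype (inclW R i w) = split (w : TensorAlgebra k V) := by
  have h := LinearEquiv.apply_symm_apply (LinearEquiv.ofInjective _ (lTensor_W_injective R i))
    (split.restrict (fun _ hw => split_mem_tensorSub_W R i hw) w)
  exact congrArg Subtype.val h

/-- The right multiplication by generators `A ⊗ V → A`, `a ⊗ v ↦ a v`, as a map of left
`A`-modules. -/
noncomputable def mulGen (R : Submodule k (V ⊗[k] V)) :
    QuadraticAlgebra R ⊗[k] V →ₗ[QuadraticAlgebra R] QuadraticAlgebra R :=
  TensorProduct.AlgebraTensorModule.lift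
    { toFun := fun a => LinearMap.mulLeft k a ∘ₗ (proj R).toLinearMap ∘ₗ TensorAlgebra.ι k
      map_add' := fun a b => by ext; simp [add_mul]
      map_smul' := fun a b => by ext; simp }

@[simp] theorem mulGen_tmul (R : Submodule k (V ⊗[k] V)) (a : QuadraticAlgebra R) (x : V) :
    mulGen R (a ⊗ₜ x) = a * proj R (TensorAlgebra.ι k x) := rfl

/-- The differential `δ_{i+1} : A ⊗ W_{i+1} → A ⊗ W_i` of the Koszul complex `K(A)` of left
`A`-modules: the inclusion `W_{i+1} ⊆ V ⊗ W_i` followed by `a ⊗ (v ⊗ w) ↦ a v ⊗ w`. -/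
noncomputable def koszulD (R : Submodule k (V ⊗[k] V)) (i : ℕ) :
    QuadraticAlgebra R ⊗[k] W R (i + 1) →ₗ[QuadraticAlgebra R] QuadraticAlgebra R ⊗[k] W R i :=
  TensorProduct.AlgebraTensorModule.rTensor k (W R i) (mulGen R) ∘ₗ
    (TensorProduct.AlgebraTensorModule.assoc k k (QuadraticAlgebra R)
      (QuadraticAlgebra R) V (W R i)).symm.toLinearMap ∘ₗ
    TensorProduct.AlgebraTensorModule.lTensor (QuadraticAlgebra R) (QuadraticAlgebra R) (inclW R i)

/-- `A(V, R)` is Koszul: the homology of the Koszul complex `K(A)` vanishes in every degree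
`i + 1 > 0`. -/
def IsKoszul (R : Submodule k (V ⊗[k] V)) : Prop :=
  ∀ i : ℕ, Function.Exact (koszulD R (i + 1)) (koszulD R i)

end Koszul

section Homological

open CategoryTheory CategoryTheory.Abelian

/-- The (left) global dimension of a ring: the supremum of the projective dimensions of its left
modules. -/
noncomputable def globalDimension (A : Type u) [Ring A] : WithBot ℕ∞ :=
  ⨆ M : ModuleCat.{u} A, projectiveDimension M

variable {k : Type u} [Field k] {V : Type v} [AddCommGroup V] [Module k V]

/-- The trivial left `A`-module `k`, on which `A` acts through the augmentation. -/
noncomputable def trivialModule (R : Submodule k (V ⊗[k] V)) :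
    ModuleCat.{max u v} (QuadraticAlgebra R) :=
  (ModuleCat.restrictScalars (augmentation R).toRingHom).obj (ModuleCat.of k (ULift.{v} k))

/-- `A` as a left module over itself. -/
noncomputable def regularModule (R : Submodule k (V ⊗[k] V)) :
    ModuleCat.{max u v} (QuadraticAlgebra R) :=
  ModuleCat.of (QuadraticAlgebra R) (QuadraticAlgebra R)

/-- Right multiplication by `a`, an endomorphism of the left module `A`. -/
noncomputable def rightMul (R : Submodule k (V ⊗[k] V)) (a : QuadraticAlgebra R) :
    regularModule R ⟶ regularModule R :=
  ModuleCat.ofHom (LinearMap.toSpanSingleton (QuadraticAlgebra R) (QuadraticAlgebra R) a)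

/-- The right action `(x, a) ↦ x · a` of `A` on `Ext^i_A(k, A)`, induced by the right
multiplications of `A`. -/
noncomputable def extAct (R : Submodule k (V ⊗[k] V)) {i : ℕ}
    (x : Ext (trivialModule R) (regularModule R) i) (a : QuadraticAlgebra R) :
    Ext (trivialModule R) (regularModule R) i :=
  x.comp (Ext.mk₀ (rightMul R a)) (add_zero i)

/-- `A = A(V, R)` is AS-Gorenstein: it has finite global dimension `d ≥ 1`, `Ext^i_A(k, A) = 0` for
`i ≠ d`, and `Ext^d_A(k, A)` is isomorphic to the trivial module `k` as a right `A`-module. -/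
def IsASGorenstein (R : Submodule k (V ⊗[k] V)) : Prop :=
  ∃ d : ℕ, 1 ≤ d ∧ globalDimension (QuadraticAlgebra R) = (d : WithBot ℕ∞) ∧
    (∀ i : ℕ, i ≠ d → Subsingleton (Ext (trivialModule R) (regularModule R) i)) ∧
    ∃ e : Ext (trivialModule R) (regularModule R) d ≃+ k,
      ∀ (x : Ext (trivialModule R) (regularModule R) d) (a : QuadraticAlgebra R),
        e (extAct R x a) = e x * augmentation R a

end Homological

section Relation

variable {k : Type u} [Field k] {V : Type v} [AddCommGroup V] [Module k V]

/-- The matrix `M(f) = (f_ij)` of coefficients of `f = ∑ f_ij x_i x_j` relative to a basis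
`(x_i)`. -/
noncomputable def coeffMatrix {n : ℕ} (b : Module.Basis (Fin n) k V) (f : V ⊗[k] V) :
    Matrix (Fin n) (Fin n) k :=
  Matrix.of fun i j => (b.tensorProduct b).repr f (i, j)

/-- Property (P2): in some basis of `V`, all the entries of `M(f)` are zero, except one which is
located on the diagonal. -/
def PropertyP2 (f : V ⊗[k] V) : Prop :=
  ∃ (n : ℕ) (b : Module.Basis (Fin n) k V) (i : Fin n), coeffMatrix b f i i ≠ 0 ∧
    ∀ p q : Fin n, (p, q) ≠ (i, i) → coeffMatrix b f p q = 0

/-- `f` is a symmetric tensor: it is invariant under exchange of the two factors. -/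
def IsSymmetricTensor (f : V ⊗[k] V) : Prop :=
  TensorProduct.comm k V V f = f

end Relation

end QuadAlg

/-! A rank one tensor is `f = u ⊗ v` with `u, v ≠ 0`, so `A` is `T(V)` with the single relation `u v
= 0`, and everything depends on whether `v` is proportional to `u`.

The tool in both cases is `exists_derivation`: a derivation `D` from `A` to `Hom(M, N)` may be
prescribed by `δ` on `V` as soon as it respects the relation, that is `u δ(v) + δ(u) v = 0`.
Suitable choices of `N` give the annihilator of `u` (`eq_zero_of_mul_eq_zero`, `exists_eq_mul`) and
exactness at the middle terms (`exists_eq_tmul`, `exact_resD2_resD1`), with no normal form for the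
elements of `A`.

If `u, v` are independent, right multiplication by `u` is injective and `W_m = 0` for `m ≥ 3`, so
the Koszul complex stops after the injective map `δ_2`. Every module `M` has the resolution `0 → A ⊗
M → A ⊗ V ⊗ M → A ⊗ M → M → 0`, so the global dimension is at most `2`. Some class in `Ext²(k, A)`
is not killed by the generator `v`: otherwise `v ∈ u A`, which fails in degree one. Hence the
dimension is exactly `2`, and `Ext²(k, A)` is not the trivial right module.

If `v = c u`, the relation is `u² = 0`, `W_m` is the line of `u ^ m` for `m ≥ 2`, and the left
annihilator of `u` is `A u`; this gives Koszulity. The sequence `0 → A u → A → A u → 0` is then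
exact and does not split, so `A u` has infinite projective dimension. This is also exactly the case
where `f` is symmetric, and where completing `u` to a basis gives (P2). -/

namespace QuadAlg

/-! ### Universal property of the algebra with one relation `u v = 0` -/

section Presentation

variable {k : Type*} [Field k] {V : Type*} [AddCommGroup V] [Module k V]

/-- The generators `V → A(V, R)`. -/
noncomputable def gen (R : Submodule k (V ⊗[k] V)) : V →ₗ[k] QuadraticAlgebra R :=
  (proj R).toLinearMap ∘ₗ TensorAlgebra.ι k

theorem proj_ι (R : Submodule k (V ⊗[k] V)) (x : V) :
    proj R (TensorAlgebra.ι k x) = gen R x := rfl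

theorem proj_surjective (R : Submodule k (V ⊗[k] V)) : Function.Surjective (proj R) :=
  RingQuot.mkAlgHom_surjective k _

theorem proj_toTensorAlgebra (R : Submodule k (V ⊗[k] V)) {r : V ⊗[k] V} (hr : r ∈ R) :
    proj R (toTensorAlgebra r) = 0 := by
  have h := RingQuot.mkAlgHom_rel k
    (s := fun a b : TensorAlgebra k V => (∃ r ∈ R, toTensorAlgebra r = a) ∧ b = 0)
    (x := toTensorAlgebra r) (y := 0) ⟨⟨r, hr, rfl⟩, rfl⟩
  rw [map_zero] at h
  exact h

theorem gen_mul_gen_eq_zero {R : Submodule k (V ⊗[k] V)} {x y : V} (h : x ⊗ₜ[k] y ∈ R) :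
    gen R x * gen R y = 0 := by
  rw [← proj_toTensorAlgebra R h, toTensorAlgebra_tmul, map_mul]
  rfl

theorem augmentation_gen (R : Submodule k (V ⊗[k] V)) (x : V) :
    augmentation R (gen R x) = 0 := by
  rw [← proj_ι, augmentation_proj]
  simp [TensorAlgebra.algebraMapInv]

variable {B : Type*} [Ring B] [Algebra k B]

/-- The universal property of the algebra with the single relation `u v = 0`. -/
theorem exists_algHom_of_mul_eq_zero {u v : V} (g : V →ₗ[k] B) (h : g u * g v = 0) :
    ∃ φ : QuadraticAlgebra (Submodule.span k {u ⊗ₜ[k] v}) →ₐ[k] B,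
      ∀ x, φ (gen _ x) = g x := by
  refine ⟨RingQuot.liftAlgHom k ⟨TensorAlgebra.lift k g, ?_⟩, fun x => ?_⟩
  · rintro a b ⟨⟨r, hr, rfl⟩, rfl⟩
    obtain ⟨c, rfl⟩ := Submodule.mem_span_singleton.1 hr
    simp [h]
  · rw [← proj_ι, proj, RingQuot.liftAlgHom_mkAlgHom_apply, TensorAlgebra.lift_ι_apply]

/-- `γ : V → A` presents `A` as the algebra with the single relation `u v = 0`. -/
def IsPresentation {A : Type*} [Ring A] [Algebra k A] (γ : V →ₗ[k] A) (u v : V) : Prop :=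
  ∃ e : QuadraticAlgebra (Submodule.span k {u ⊗ₜ[k] v}) ≃ₐ[k] A, ∀ x, e (gen _ x) = γ x

theorem isPresentation_gen (u v : V) :
    IsPresentation (gen (Submodule.span k {u ⊗ₜ[k] v})) u v :=
  ⟨AlgEquiv.refl, fun _ => rfl⟩

end Presentation

/-! ### Derivations, annihilators and the degree one part -/

namespace IsPresentation

variable {k : Type*} [Field k] {V : Type*} [AddCommGroup V] [Module k V]
  {A : Type*} [Ring A] [Algebra k A] {γ : V →ₗ[k] A} {u v : V}

theorem mul_eq_zero (h : IsPresentation γ u v) : γ u * γ v = 0 := by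
  obtain ⟨e, he⟩ := h
  rw [← he, ← he, ← map_mul, gen_mul_gen_eq_zero (Submodule.mem_span_singleton_self _), map_zero]

theorem induction (h : IsPresentation γ u v)
    {P : A → Prop} (algebraMap : ∀ c, P (algebraMap k _ c))
    (gen : ∀ x, P (γ x)) (mul : ∀ a b, P a → P b → P (a * b))
    (add : ∀ a b, P a → P b → P (a + b)) (a : A) : P a := by
  obtain ⟨e, he⟩ := h
  obtain ⟨a, rfl⟩ := e.surjective a
  obtain ⟨t, rfl⟩ := proj_surjective _ a
  induction t using TensorAlgebra.induction with
  | algebraMap c => rw [AlgHom.commutes, AlgEquiv.commutes]; exact algebraMap c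
  | ι x => rw [proj_ι, he]; exact gen x
  | mul a b ha hb => rw [map_mul, map_mul]; exact mul _ _ ha hb
  | add a b ha hb => rw [map_add, map_add]; exact add _ _ ha hb

theorem exists_algHom (h : IsPresentation γ u v) {B : Type*} [Ring B] [Algebra k B]
    (g : V →ₗ[k] B) (hg : g u * g v = 0) : ∃ φ : A →ₐ[k] B, ∀ x, φ (γ x) = g x := by
  obtain ⟨e, he⟩ := h
  obtain ⟨φ, hφ⟩ := exists_algHom_of_mul_eq_zero g hg
  refine ⟨φ.comp e.symm.toAlgHom, fun x => ?_⟩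
  rw [← he, ← hφ]
  simp

/-- A derivation from `A` to the bimodule `Hom(M, N)` may be prescribed on the generators. -/
theorem exists_derivation (h : IsPresentation γ u v) {M N : Type*} [AddCommGroup M] [Module k M] [AddCommGroup N]
    [Module k N] [Module A N] [IsScalarTower k A N] (ρ : A →ₐ[k] Module.End k M)
    (δ : V →ₗ[k] M →ₗ[k] N) (hδ : ∀ m, γ u • δ v m + δ u (ρ (γ v) m) = 0) :
    ∃ D : A →ₗ[k] M →ₗ[k] N, ∀ a x m,
      D (a * γ x) m = a • δ x m + D a (ρ (γ x) m) := by
  -- A derivation is the off-diagonal entry of a triangular representation on `N × M`; the product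
  -- for `u v` vanishes because of `hδ`.
  let g : V →ₗ[k] Module.End k (N × M) :=
    { toFun := fun x => LinearMap.prod
        ((Algebra.lsmul k k N (γ x)).coprod (δ x)) (ρ (γ x) ∘ₗ LinearMap.snd k N M)
      map_add' := fun x y => by
        ext <;> simp
      map_smul' := fun c x => by
        ext <;> simp }
  have hg : ∀ x n m, g x (n, m) = (γ x • n + δ x m, ρ (γ x) m) := fun _ _ _ => rfl
  obtain ⟨φ, hφ⟩ := h.exists_algHom g (by
    refine LinearMap.ext fun ⟨n, m⟩ => ?_
    rw [Module.End.mul_apply, hg, hg, smul_add, smul_smul, h.mul_eq_zero, zero_smul, zero_add,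
      hδ, ← Module.End.mul_apply, ← map_mul, h.mul_eq_zero, map_zero]
    rfl)
  have key : ∀ a n m, φ a (n, m) = (a • n + (φ a (0, m)).1, ρ a m) := by
    intro a
    induction a using h.induction with
    | algebraMap c => intro n m; simp [Module.algebraMap_end_apply]
    | gen x => intro n m; simp [hφ, hg]
    | mul a b ha hb =>
      intro n m
      rw [map_mul, Module.End.mul_apply, Module.End.mul_apply, hb n m, hb 0 m, ha, ha (_ + _) _]
      simp [mul_smul, add_assoc]
    | add a b ha hb =>
      intro n m
      rw [map_add, LinearMap.add_apply, LinearMap.add_apply, ha n m, hb n m]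
      simp only [Prod.mk_add_mk, add_smul, map_add, LinearMap.add_apply, Prod.fst_add]
      congr 1
      abel
  refine ⟨{ toFun := fun a => LinearMap.fst k N M ∘ₗ φ a ∘ₗ LinearMap.inr k N M
            map_add' := fun a b => by ext; simp
            map_smul' := fun c a => by ext; simp }, fun a x m => ?_⟩
  change (φ (a * γ x) (0, m)).1 = a • δ x m + (φ a (0, ρ (γ x) m)).1
  rw [map_mul, Module.End.mul_apply, hφ, hg, key]
  simp

/-- The special case of `exists_derivation` where the right structure is the trivial one. -/
theorem exists_linearMap_mul_gen (h : IsPresentation γ u v) {N : Type*} [AddCommGroup N]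
    [Module k N] [Module A N] [IsScalarTower k A N]
    (δ : V →ₗ[k] N) (hδ : γ u • δ v = 0) :
    ∃ D : A →ₗ[k] N, ∀ a x, D (a * γ x) = a • δ x := by
  -- With `M = k` acted on through the augmentation, the term `D a (x m)` of the Leibniz rule
  -- disappears.
  obtain ⟨ε, hε⟩ := h.exists_algHom (0 : V →ₗ[k] k) (by simp)
  replace hε : ∀ x, ε (γ x) = 0 := hε
  obtain ⟨D, hD⟩ := h.exists_derivation (M := k) (N := N) ((Algebra.lmul k k).comp ε)
    ((LinearMap.ringLmapEquivSelf k k N).symm.toLinearMap ∘ₗ δ)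
    (fun m => by simp [hε, smul_comm _ m, hδ])
  refine ⟨LinearMap.applyₗ 1 ∘ₗ D, fun a x => ?_⟩
  have := hD a x 1
  simpa [hε] using this

/-- Right multiplication by `u` is injective when `v` is not proportional to `u`. -/
theorem eq_zero_of_mul_eq_zero (h : IsPresentation γ u v) {φ : V →ₗ[k] k} (hu : φ u ≠ 0) (hv : φ v = 0) {a : A}
    (ha : a * γ u = 0) : a = 0 := by
  -- Taking `δ = φ` gives `D (a x) = φ(x) a`, which recovers `a` from `a u`; the relation is
  -- respected because `φ v = 0`.
  obtain ⟨D, hD⟩ := h.exists_linearMap_mul_gen (N := A)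
    ((LinearMap.toSpanSingleton k _ 1) ∘ₗ φ) (by simp [hv])
  have := hD a u
  rw [ha, map_zero] at this
  simpa [hu] using this.symm

/-- In the algebra with relation `u ^ 2 = 0`, the left annihilator of `u` is `A u`. -/
theorem exists_eq_mul (h : IsPresentation γ u u) (hu : u ≠ 0) {a : A}
    (ha : a * γ u = 0) : ∃ b, a = b * γ u := by
  obtain ⟨φ, hφ⟩ := Module.Projective.exists_dual_ne_zero (R := k) hu
  -- Here `φ u ≠ 0`, so the relation is respected only modulo `A u`, and `a u = 0` yields `a = 0`
  -- only in this quotient.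
  let N := A ⧸ Submodule.span A {γ u}
  obtain ⟨D, hD⟩ := h.exists_linearMap_mul_gen (N := N)
    ((LinearMap.toSpanSingleton k N (Submodule.Quotient.mk 1)) ∘ₗ φ) (by
      rw [LinearMap.comp_apply, LinearMap.toSpanSingleton_apply, smul_comm,
        ← Submodule.Quotient.mk_smul, smul_eq_mul, mul_one,
        (Submodule.Quotient.mk_eq_zero _).2 (Submodule.mem_span_singleton_self _), smul_zero])
  have h' := hD a u
  rw [ha, map_zero, LinearMap.comp_apply, LinearMap.toSpanSingleton_apply, smul_comm,
    ← Submodule.Quotient.mk_smul, smul_eq_mul, mul_one, eq_comm, smul_eq_zero_iff_right hφ,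
    Submodule.Quotient.mk_eq_zero, Submodule.mem_span_singleton] at h'
  obtain ⟨b, hb⟩ := h'
  exact ⟨b, hb.symm⟩

/-- The algebra map from `A` to the square zero extension `k ⊕ V`. -/
theorem exists_algHom_trivSqZeroExt (h : IsPresentation γ u v) [Module kᵐᵒᵖ V] [IsCentralScalar k V] :
    ∃ φ : A →ₐ[k] TrivSqZeroExt k V, ∀ x, φ (γ x) = TrivSqZeroExt.inr x :=
  h.exists_algHom (TrivSqZeroExt.inrHom k V) (by simp)

/-- Degree one comparison: in `k ⊕ V`, where `V · V = 0`, only the scalar part of `a` contributes to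
`x a`. -/
theorem mem_span_of_eq_mul (h : IsPresentation γ u v) {x y : V} {a : A} (hxy : γ y = γ x * a) :
    y ∈ Submodule.span k {x} := by
  let _ : Module kᵐᵒᵖ V := Module.compHom _ ((RingHom.id k).fromOpposite mul_comm)
  have : IsCentralScalar k V := ⟨fun _ _ => rfl⟩
  obtain ⟨φ, hφ⟩ := h.exists_algHom_trivSqZeroExt
  have h' := congrArg TrivSqZeroExt.snd (congrArg φ hxy)
  rw [map_mul, hφ, hφ, TrivSqZeroExt.snd_mul] at h'
  simp only [TrivSqZeroExt.snd_inr, TrivSqZeroExt.fst_inr, zero_smul, op_smul_eq_smul,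
    zero_add] at h'
  exact Submodule.mem_span_singleton.2 ⟨_, h'.symm⟩

/-- The square zero extension is commutative, so `a x` and `x a` have the same image there. This is
what prevents `A u` from being projective when `u² = 0`. -/
theorem eq_zero_of_mul_eq_self (h : IsPresentation γ u v) {x : V} {a : A}
    (hax : a * γ x = γ x) (hxa : γ x * a = 0) : x = 0 := by
  let _ : Module kᵐᵒᵖ V := Module.compHom _ ((RingHom.id k).fromOpposite mul_comm)
  have : IsCentralScalar k V := ⟨fun _ _ => rfl⟩
  obtain ⟨φ, hφ⟩ := h.exists_algHom_trivSqZeroExt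
  have h₁ := congrArg φ hax
  rw [map_mul, mul_comm, ← map_mul, hxa, map_zero, hφ] at h₁
  exact TrivSqZeroExt.inr_injective (h₁.symm.trans (TrivSqZeroExt.inr_zero k).symm)

end IsPresentation

/-! ### A functorial resolution of length two of every module -/

section Resolution

variable {k : Type*} [Field k] {V : Type*} [AddCommGroup V] [Module k V]

/-- The `A`-linear map `A ⊗ X → N` extending a `k`-linear map `X → N`. -/
noncomputable def freeLift {A X N : Type*} [Ring A] [Algebra k A] [AddCommGroup X] [Module k X]
    [AddCommGroup N] [Module k N] [Module A N] [IsScalarTower k A N] (g : X →ₗ[k] N) :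
    A ⊗[k] X →ₗ[A] N :=
  TensorProduct.AlgebraTensorModule.lift (LinearMap.toSpanSingleton A (X →ₗ[k] N) g)

@[simp] theorem freeLift_tmul {A X N : Type*} [Ring A] [Algebra k A] [AddCommGroup X]
    [Module k X] [AddCommGroup N] [Module k N] [Module A N] [IsScalarTower k A N]
    (g : X →ₗ[k] N) (a : A) (x : X) : freeLift g (a ⊗ₜ[k] x) = a • g x := rfl

variable {A : Type*} [Ring A] [Algebra k A] (γ : V →ₗ[k] A) (u v : V)
  (M : Type*) [AddCommGroup M] [Module k M] [Module A M] [IsScalarTower k A M]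

/-- The action `A ⊗ M → M`. -/
noncomputable def resD0 (A : Type*) [Ring A] [Algebra k A] (M : Type*) [AddCommGroup M] [Module k M]
    [Module A M] [IsScalarTower k A M] : A ⊗[k] M →ₗ[A] M := freeLift LinearMap.id

/-- The map `A ⊗ V ⊗ M → A ⊗ M`, `a ⊗ x ⊗ m ↦ a x ⊗ m - a ⊗ x m`. -/
noncomputable def resD1 : A ⊗[k] (V ⊗[k] M) →ₗ[A] A ⊗[k] M :=
  freeLift (TensorProduct.lift (LinearMap.mk₂ k (fun x m => γ x ⊗ₜ m - 1 ⊗ₜ (γ x • m))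
    (fun x y m => by simp only [map_add, add_tmul, add_smul, tmul_add]; abel)
    (fun c x m => by simp only [map_smul, smul_assoc, tmul_smul, ← smul_tmul', smul_sub])
    (fun x m n => by simp only [tmul_add, smul_add]; abel)
    (fun c x m => by simp only [smul_comm _ c, tmul_smul, smul_sub])))

/-- The map `A ⊗ M → A ⊗ V ⊗ M`, `a ⊗ m ↦ a u ⊗ v ⊗ m + a ⊗ u ⊗ v m`. -/
noncomputable def resD2 : A ⊗[k] M →ₗ[A] A ⊗[k] (V ⊗[k] M) :=
  freeLift (TensorProduct.mk k A _ (γ u) ∘ₗ TensorProduct.mk k V M v +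
    TensorProduct.mk k A _ 1 ∘ₗ TensorProduct.mk k V M u ∘ₗ Algebra.lsmul k k M (γ v))

variable {M}

theorem resD0_tmul (a : A) (m : M) : resD0 (k := k) A M (a ⊗ₜ m) = a • m := rfl

theorem resD1_tmul (a : A) (x : V) (m : M) :
    resD1 γ M (a ⊗ₜ (x ⊗ₜ m)) = (a * γ x) ⊗ₜ m - a ⊗ₜ (γ x • m) := by
  simp [resD1, smul_sub, TensorProduct.smul_tmul']

theorem resD2_tmul (a : A) (m : M) :
    resD2 γ u v M (a ⊗ₜ m) = (a * γ u) ⊗ₜ (v ⊗ₜ m) + a ⊗ₜ (u ⊗ₜ (γ v • m)) := by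
  simp [resD2, smul_add, TensorProduct.smul_tmul']

variable (M)
variable {γ} {u v}

theorem resD0_surjective : Function.Surjective (resD0 (k := k) A M) := fun m =>
  ⟨1 ⊗ₜ m, by simp [resD0_tmul]⟩

/-- Modulo the image of `resD1`, letters move across the tensor sign, so `a ⊗ m` becomes `1 ⊗ a m`;
a tensor killed by the action is therefore in the image. -/
theorem IsPresentation.exact_resD1_resD0 (h : IsPresentation γ u v) :
    Function.Exact (resD1 γ M) (resD0 (k := k) A M) := by
  have h₀ : ∀ z, resD0 (k := k) A M (resD1 γ M z) = 0 := by
    intro z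
    induction z with
    | zero => simp
    | add z w hz hw => rw [map_add, map_add, hz, hw, add_zero]
    | tmul a t =>
      induction t with
      | zero => simp
      | add z w hz hw => rw [tmul_add, map_add, map_add, hz, hw, add_zero]
      | tmul x m => rw [resD1_tmul, map_sub, resD0_tmul, resD0_tmul, mul_smul, sub_self]
  have h₁ : ∀ (a : A) (m : M), a ⊗ₜ m - 1 ⊗ₜ (a • m) ∈ (resD1 γ M).range := by
    intro a
    induction a using h.induction with
    | algebraMap c =>
      intro m
      rw [Algebra.algebraMap_eq_smul_one, smul_tmul, smul_assoc, one_smul, sub_self]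
      exact Submodule.zero_mem _
    | gen x =>
      intro m
      exact ⟨1 ⊗ₜ (x ⊗ₜ m), by rw [resD1_tmul, one_mul]⟩
    | mul a b ha hb =>
      intro m
      have := Submodule.add_mem _ (Submodule.smul_mem _ a (hb m)) (ha (b • m))
      rwa [smul_sub, smul_tmul', smul_tmul', smul_eq_mul, smul_eq_mul, mul_one,
        sub_add_sub_cancel, smul_smul] at this
    | add a b ha hb =>
      intro m
      have := Submodule.add_mem _ (ha m) (hb m)
      rwa [sub_add_sub_comm, ← add_tmul, ← tmul_add, ← add_smul] at this
  have h₂ : ∀ z : A ⊗[k] M, z - 1 ⊗ₜ resD0 (k := k) A M z ∈ (resD1 γ M).range := by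
    intro z
    induction z with
    | zero => simp
    | tmul a m => exact h₁ a m
    | add z w hz hw =>
      have := Submodule.add_mem _ hz hw
      rwa [sub_add_sub_comm, ← tmul_add, ← map_add] at this
  intro z
  refine ⟨fun hz => ?_, ?_⟩
  · have := h₂ z
    rwa [hz, tmul_zero, sub_zero] at this
  · rintro ⟨w, rfl⟩
    exact h₀ w

theorem IsPresentation.exact_resD2_resD1 (h : IsPresentation γ u v) :
    Function.Exact (resD2 γ u v M) (resD1 γ M) := by
  have h₀ : ∀ z, resD1 γ M (resD2 γ u v M z) = 0 := by
    intro z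
    induction z with
    | zero => simp
    | add z w hz hw => rw [map_add, map_add, hz, hw, add_zero]
    | tmul a m =>
      rw [resD2_tmul, map_add, resD1_tmul, resD1_tmul, mul_assoc, h.mul_eq_zero, mul_zero,
        zero_tmul, zero_sub, smul_smul, h.mul_eq_zero, zero_smul, tmul_zero, sub_zero,
        neg_add_cancel]
  -- In the cokernel of `resD2`, the class of `1 ⊗ x ⊗ m` defines a derivation `D`. It satisfies `D
  -- ∘ resD1 = q`, so the kernel of `resD1` dies in `C`.
  let C := (A ⊗[k] (V ⊗[k] M)) ⧸ (resD2 γ u v M).range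
  let q : A ⊗[k] (V ⊗[k] M) →ₗ[A] C := (resD2 γ u v M).range.mkQ
  obtain ⟨D, hD⟩ := h.exists_derivation (M := M) (N := C) (Algebra.lsmul k k M)
    (LinearMap.llcomp k M _ C (q.restrictScalars k ∘ₗ TensorProduct.mk k A (V ⊗[k] M) 1) ∘ₗ
      TensorProduct.mk k V M) (fun m => by
        change γ u • q (1 ⊗ₜ (v ⊗ₜ m)) + q (1 ⊗ₜ (u ⊗ₜ (γ v • m))) = 0
        rw [← map_smul, ← map_add, smul_tmul', smul_eq_mul, mul_one]
        refine (Submodule.Quotient.mk_eq_zero _).2 ⟨1 ⊗ₜ m, ?_⟩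
        rw [resD2_tmul, one_mul])
  have hD' : ∀ a x m, D (a * γ x) m = q (a ⊗ₜ (x ⊗ₜ m)) + D a (γ x • m) := fun a x m => by
    refine (hD a x m).trans (congrArg₂ _ ?_ rfl)
    change a • q (1 ⊗ₜ (x ⊗ₜ m)) = _
    rw [← map_smul, smul_tmul', smul_eq_mul, mul_one]
  have h₁ : ∀ z, TensorProduct.lift D (resD1 γ M z) = q z := by
    intro z
    induction z with
    | zero => simp
    | add z w hz hw => rw [map_add, map_add, map_add, hz, hw]
    | tmul a t =>
      induction t with
      | zero => simp
      | add z w hz hw => rw [tmul_add, map_add, map_add, map_add, hz, hw]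
      | tmul x m =>
        rw [resD1_tmul, map_sub, TensorProduct.lift.tmul, TensorProduct.lift.tmul, hD',
          add_sub_cancel_right]
  intro z
  refine ⟨fun hz => ?_, ?_⟩
  · have := h₁ z
    rw [hz, map_zero] at this
    exact (Submodule.Quotient.mk_eq_zero _).1 this.symm
  · rintro ⟨w, rfl⟩
    exact h₀ w

/-- Contracting the factor `V` with `ψ` kills the term in `u` and leaves right multiplication by
`u`, tensored with `M`. That map is injective by flatness over `k`. -/
theorem IsPresentation.resD2_injective (h : IsPresentation γ u v) {φ ψ : V →ₗ[k] k} (hu : φ u ≠ 0) (hv : φ v = 0) (hu' : ψ u = 0)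
    (hv' : ψ v = 1) : Function.Injective (resD2 γ u v M) := by
  let p : A ⊗[k] (V ⊗[k] M) →ₗ[k] A ⊗[k] M :=
    LinearMap.lTensor A ((TensorProduct.lid k M).toLinearMap ∘ₗ LinearMap.rTensor M ψ)
  have hp : ∀ z, p (resD2 γ u v M z) = LinearMap.rTensor M (LinearMap.mulRight k (γ u)) z := by
    intro z
    induction z with
    | zero => simp
    | add z w hz hw => rw [map_add, map_add, map_add, hz, hw]
    | tmul a m => rw [resD2_tmul]; simp [p, hu', hv']
  have hinj : Function.Injective (LinearMap.rTensor M (LinearMap.mulRight k (γ u))) :=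
    Module.Flat.rTensor_preserves_injective_linearMap _
      ((injective_iff_map_eq_zero _).2 fun a ha => h.eq_zero_of_mul_eq_zero hu hv ha)
  intro z w hzw
  apply hinj
  rw [← hp, ← hp, hzw]

end Resolution

/-! ### Koszulity in the two cases -/

section Koszul

variable {k : Type*} [Field k] {V : Type*} [AddCommGroup V] [Module k V]

/-- The derivation argument again, with values in the quotient by `A (u ⊗ v)`. The surjection `j`
lets `W_1` play the role of `V`. -/
theorem IsPresentation.exists_eq_tmul {A : Type*} [Ring A] [Algebra k A] {γ : V →ₗ[k] A} {u v : V}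
    (h : IsPresentation γ u v) {X : Type*} [AddCommGroup X] [Module k X] (j : V →ₗ[k] X)
    (hj : Function.Surjective j) (p : A ⊗[k] X →ₗ[k] A)
    (hp : ∀ a x, p (a ⊗ₜ j x) = a * γ x) {z : A ⊗[k] X} (hz : p z = 0) :
    ∃ a, z = (a * γ u) ⊗ₜ j v := by
  let C := (A ⊗[k] X) ⧸ Submodule.span A {γ u ⊗ₜ[k] j v}
  let q : A ⊗[k] X →ₗ[A] C := Submodule.mkQ _
  obtain ⟨D, hD⟩ := h.exists_linearMap_mul_gen (N := C)
    (q.restrictScalars k ∘ₗ TensorProduct.mk k A X 1 ∘ₗ j) (by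
      change γ u • q (1 ⊗ₜ j v) = 0
      rw [← map_smul, smul_tmul', smul_eq_mul, mul_one]
      exact (Submodule.Quotient.mk_eq_zero _).2 (Submodule.mem_span_singleton_self _))
  have hDp : ∀ z, D (p z) = q z := by
    intro z
    induction z with
    | zero => simp
    | add z w hz hw => rw [map_add, map_add, map_add, hz, hw]
    | tmul a x =>
      obtain ⟨x, rfl⟩ := hj x
      rw [hp, hD]
      change a • q (1 ⊗ₜ j x) = _
      rw [← map_smul, smul_tmul', smul_eq_mul, mul_one]
  have hqz := hDp z
  rw [hz, map_zero] at hqz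
  obtain ⟨a, ha⟩ := Submodule.mem_span_singleton.1
    ((Submodule.Quotient.mk_eq_zero _).1 hqz.symm)
  exact ⟨a, by rw [← ha, smul_tmul', smul_eq_mul]⟩

theorem eq_zero_of_tmul_eq_zero {A X : Type*} [AddCommMonoid A] [Module k A] [AddCommGroup X]
    [Module k X] {a : A} {x : X} (hx : x ≠ 0) (h : a ⊗ₜ[k] x = 0) : a = 0 := by
  obtain ⟨φ, hφ⟩ := Module.Projective.exists_dual_ne_zero (R := k) hx
  have h' := congrArg (TensorProduct.rid k A ∘ LinearMap.lTensor A φ) h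
  simp only [Function.comp_apply, LinearMap.lTensor_tmul, rid_tmul, map_zero] at h'
  have := congrArg (fun y => (φ x)⁻¹ • y) h'
  simpa [smul_smul, hφ] using this

theorem exists_eq_tmul_of_forall_eq_smul {A X : Type*} [AddCommMonoid A] [Module k A]
    [AddCommMonoid X] [Module k X] {x : X} (hx : ∀ y : X, ∃ c : k, y = c • x) (z : A ⊗[k] X) :
    ∃ a, z = a ⊗ₜ x := by
  induction z with
  | zero => exact ⟨0, (zero_tmul _ _).symm⟩
  | add z w hz hw =>
    obtain ⟨a, rfl⟩ := hz
    obtain ⟨b, rfl⟩ := hw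
    exact ⟨a + b, (add_tmul _ _ _).symm⟩
  | tmul a y =>
    obtain ⟨c, rfl⟩ := hx y
    exact ⟨c • a, by rw [smul_tmul]⟩

theorem koszulD_tmul (R : Submodule k (V ⊗[k] V)) (i : ℕ) (a : QuadraticAlgebra R)
    {w : W R (i + 1)} {x : V} {w' : W R i}
    (hw : (w : TensorAlgebra k V) = TensorAlgebra.ι k x * w') :
    koszulD R i (a ⊗ₜ w) = (a * gen R x) ⊗ₜ w' := by
  have hincl : inclW R i w = x ⊗ₜ w' := by
    apply lTensor_W_injective R i
    rw [lTensor_inclW, hw, split_ι_mul]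
    rfl
  change TensorProduct.AlgebraTensorModule.rTensor k (W R i) (mulGen R)
    ((TensorProduct.AlgebraTensorModule.assoc k k (QuadraticAlgebra R)
      (QuadraticAlgebra R) V (W R i)).symm (a ⊗ₜ inclW R i w)) = _
  rw [hincl]
  rfl

theorem mem_W_zero {R : Submodule k (V ⊗[k] V)} : (1 : TensorAlgebra k V) ∈ W R 0 := by
  refine Submodule.mem_inf.2 ⟨by simp, ?_⟩
  simp only [Submodule.mem_iInf]
  intro i j hij
  omega

theorem mem_W_one {R : Submodule k (V ⊗[k] V)} {w : TensorAlgebra k V} :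
    w ∈ W R 1 ↔ ∃ x, TensorAlgebra.ι k x = w := by
  rw [W, Submodule.mem_inf, pow_one, LinearMap.mem_range, and_iff_left]
  simp only [Submodule.mem_iInf]
  intro i j hij
  omega

/-- Since `W_{m+1} ⊆ V ⊗ W_m`, contracting the first letter with a functional nonzero on `x` leaves
a nonzero multiple of `t` in `W_m`. -/
theorem mem_of_ι_mul_mem_W {R : Submodule k (V ⊗[k] V)} {m : ℕ} {x : V} (hx : x ≠ 0)
    {t : TensorAlgebra k V} (h : TensorAlgebra.ι k x * t ∈ W R (m + 1)) : t ∈ W R m := by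
  obtain ⟨φ, hφ⟩ := Module.Projective.exists_dual_ne_zero (R := k) hx
  have := (mem_tensorSub_iff _ _).1 (split_mem_tensorSub_W R m h) φ
  rw [split_ι_mul, LinearMap.rTensor_tmul, lid_tmul] at this
  exact (Submodule.smul_mem_iff _ hφ).1 this

variable {u v : V}

theorem exists_eq_of_mem_W {m : ℕ} {w : TensorAlgebra k V}
    (hw : w ∈ W (Submodule.span k {u ⊗ₜ[k] v}) (m + 2)) :
    ∃ t, w = TensorAlgebra.ι k u * (TensorAlgebra.ι k v * t) := by
  have h := (Submodule.mem_inf.1 hw).2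
  simp only [Submodule.mem_iInf] at h
  have h' := h 0 m (by omega)
  rw [pow_zero, one_mul, Submodule.map_span, Set.image_singleton, toTensorAlgebra_tmul,
    Submodule.mem_span_singleton_mul] at h'
  obtain ⟨t, -, rfl⟩ := h'
  exact ⟨t, mul_assoc _ _ _⟩

theorem ι_mul_ι_mem_W :
    TensorAlgebra.ι k u * TensorAlgebra.ι k v ∈ W (Submodule.span k {u ⊗ₜ[k] v}) 2 := by
  refine Submodule.mem_inf.2 ⟨?_, ?_⟩
  · rw [pow_two]
    exact Submodule.mul_mem_mul (LinearMap.mem_range_self _ _) (LinearMap.mem_range_self _ _)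
  · simp only [Submodule.mem_iInf]
    intro i j hij
    obtain ⟨rfl, rfl⟩ : i = 0 ∧ j = 0 := by omega
    rw [pow_zero, one_mul, mul_one, Submodule.map_span, Set.image_singleton, toTensorAlgebra_tmul]
    exact Submodule.mem_span_singleton_self _

theorem ι_injective : Function.Injective (TensorAlgebra.ι k (M := V)) := fun x y h => by
  have := TensorAlgebra.ι_leftInverse (R := k) (M := V)
  exact this.injective h

theorem exists_smul_of_mem_W_two {w : TensorAlgebra k V}
    (hw : w ∈ W (Submodule.span k {u ⊗ₜ[k] v}) 2) :
    ∃ c : k, w = c • (TensorAlgebra.ι k u * TensorAlgebra.ι k v) := by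
  have h := (Submodule.mem_inf.1 hw).2
  simp only [Submodule.mem_iInf] at h
  have h' := h 0 0 rfl
  rw [pow_zero, one_mul, mul_one, Submodule.map_span, Set.image_singleton, toTensorAlgebra_tmul,
    Submodule.mem_span_singleton] at h'
  obtain ⟨c, hc⟩ := h'
  exact ⟨c, hc.symm⟩

theorem ι_mul_injective {x : V} (hx : x ≠ 0) {t : TensorAlgebra k V}
    (h : TensorAlgebra.ι k x * t = 0) : t = 0 := by
  obtain ⟨φ, hφ⟩ := Module.Projective.exists_dual_ne_zero (R := k) hx
  have h' := congrArg (TensorProduct.lid k _ ∘ LinearMap.rTensor (TensorAlgebra k V) φ ∘ split) h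
  simpa [hφ] using h'

/-- Exactness of the Koszul complex at `A ⊗ W₁`. -/
theorem exact_koszulD_zero :
    Function.Exact (koszulD (Submodule.span k {u ⊗ₜ[k] v}) 1)
      (koszulD (Submodule.span k {u ⊗ₜ[k] v}) 0) := by
  set R := Submodule.span k {u ⊗ₜ[k] v} with hR
  let j : V →ₗ[k] W R 1 := (TensorAlgebra.ι k).codRestrict _ fun x => mem_W_one.2 ⟨x, rfl⟩
  have hj : Function.Surjective j := fun ⟨w, hw⟩ => by
    obtain ⟨x, rfl⟩ := mem_W_one.1 hw
    exact ⟨x, rfl⟩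
  have h₀ : ∀ a x, koszulD R 0 (a ⊗ₜ j x) = (a * gen R x) ⊗ₜ ⟨1, mem_W_zero⟩ := fun a x =>
    koszulD_tmul R 0 a (by simp [j])
  let w₂ : W R 2 := ⟨_, ι_mul_ι_mem_W (u := u) (v := v)⟩
  have h₁ : ∀ a, koszulD R 1 (a ⊗ₜ w₂) = (a * gen R u) ⊗ₜ j v := fun a =>
    koszulD_tmul R 1 a rfl
  -- This is `δ_1` followed by the multiplication `A ⊗ W_0 → A`.
  let p : QuadraticAlgebra R ⊗[k] W R 1 →ₗ[k] QuadraticAlgebra R :=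
    LinearMap.mul' k (QuadraticAlgebra R) ∘ₗ
      LinearMap.lTensor (QuadraticAlgebra R) ((proj R).toLinearMap ∘ₗ (W R 0).subtype) ∘ₗ
        (koszulD R 0).restrictScalars k
  have hp : ∀ a x, p (a ⊗ₜ j x) = a * gen R x := fun a x => by
    simp [p, h₀]
  intro z
  constructor
  · intro hz
    obtain ⟨a, rfl⟩ := (isPresentation_gen (k := k) u v).exists_eq_tmul j hj p hp
      (show p z = 0 by simp [p, hz])
    exact ⟨a ⊗ₜ w₂, h₁ a⟩
  · rintro ⟨y, rfl⟩
    obtain ⟨a, rfl⟩ := exists_eq_tmul_of_forall_eq_smul (k := k) (x := w₂) (fun y => by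
      obtain ⟨c, hc⟩ := exists_smul_of_mem_W_two y.2
      exact ⟨c, Subtype.ext hc⟩) y
    rw [h₁, h₀, mul_assoc, gen_mul_gen_eq_zero (hR ▸ Submodule.mem_span_singleton_self _),
      mul_zero, zero_tmul]

/-- The Koszul complex of the algebra with the relation `u v = 0`, with `u` and `v` not
proportional. -/
theorem isKoszul_of_dual {φ ψ : V →ₗ[k] k} (hu : φ u ≠ 0) (hv : φ v = 0) (hu' : ψ u = 0)
    (hv' : ψ v = 1) : IsKoszul (Submodule.span k {u ⊗ₜ[k] v}) := by
  have hu₀ : u ≠ 0 := fun h => hu (by rw [h, map_zero])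
  have hv₀ : v ≠ 0 := fun h => by simp [h] at hv'
  -- An element `u v t` of `W_{m+3}` has `v t ∈ W_{m+2}`, hence `v t = u v s`; contracting the first
  -- letter with `ψ` gives `t = 0`.
  have hW : ∀ m, ∀ w : W (Submodule.span k {u ⊗ₜ[k] v}) (m + 3), w = 0 := by
    rintro m ⟨w, hw⟩
    obtain ⟨t, rfl⟩ := exists_eq_of_mem_W hw
    obtain ⟨s, hs⟩ := exists_eq_of_mem_W (m := m) (mem_of_ι_mul_mem_W hu₀ hw)
    have h := congrArg
      (TensorProduct.lid k _ ∘ LinearMap.rTensor (TensorAlgebra k V) ψ ∘ split) hs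
    simp only [Function.comp_apply, split_ι_mul, LinearMap.rTensor_tmul, lid_tmul, hu', hv',
      one_smul, zero_smul] at h
    exact Subtype.ext (by simp [h])
  have hsub : ∀ m, ∀ z : QuadraticAlgebra (Submodule.span k {u ⊗ₜ[k] v}) ⊗[k]
      W (Submodule.span k {u ⊗ₜ[k] v}) (m + 3), z = 0 := fun m z => by
    induction z with
    | zero => rfl
    | add z w hz hw => rw [hz, hw, add_zero]
    | tmul a w => rw [hW m w, tmul_zero]
  -- Exactness at `A ⊗ W_1`, then at `A ⊗ W_2` (injectivity of `δ_2`), then at the zero terms.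
  rintro (_ | _ | i)
  · exact exact_koszulD_zero
  · intro z
    refine ⟨fun hz => ⟨0, ?_⟩, ?_⟩
    · let w₂ : W (Submodule.span k {u ⊗ₜ[k] v}) 2 := ⟨_, ι_mul_ι_mem_W (u := u) (v := v)⟩
      obtain ⟨a, rfl⟩ := exists_eq_tmul_of_forall_eq_smul (k := k) (x := w₂) (fun y => by
        obtain ⟨c, hc⟩ := exists_smul_of_mem_W_two y.2
        exact ⟨c, Subtype.ext hc⟩) z
      rw [koszulD_tmul _ 1 a (x := u) (w' := ⟨TensorAlgebra.ι k v, mem_W_one.2 ⟨v, rfl⟩⟩) rfl] at hz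
      have ha := eq_zero_of_tmul_eq_zero (fun h => hv₀ (ι_injective (k := k) (by
        rw [map_zero]; exact congrArg Subtype.val h))) hz
      rw [(isPresentation_gen u v).eq_zero_of_mul_eq_zero hu hv ha, zero_tmul, map_zero]
    · rintro ⟨y, rfl⟩
      rw [hsub 0 y, map_zero, map_zero]
  · intro z
    rw [hsub i z, map_zero]
    exact ⟨fun _ => ⟨0, map_zero _⟩, fun _ => rfl⟩

/-- The Koszul complex of the algebra with the relation `u ^ 2 = 0`. -/
theorem isKoszul_sq (hu : u ≠ 0) : IsKoszul (Submodule.span k {u ⊗ₜ[k] u}) := by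
  set R := Submodule.span k {u ⊗ₜ[k] u} with hR
  have hmem : ∀ m, TensorAlgebra.ι k u ^ m ∈ W R m := fun m => by
    refine Submodule.mem_inf.2 ⟨Submodule.pow_mem_pow _ (LinearMap.mem_range_self _ _) _, ?_⟩
    simp only [Submodule.mem_iInf]
    rintro i j rfl
    rw [pow_add, pow_add, pow_two]
    refine Submodule.mul_mem_mul (Submodule.mul_mem_mul
      (Submodule.pow_mem_pow _ (LinearMap.mem_range_self _ _) _) ?_)
      (Submodule.pow_mem_pow _ (LinearMap.mem_range_self _ _) _)
    exact ⟨u ⊗ₜ u, Submodule.mem_span_singleton_self _, rfl⟩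
  have hspan : ∀ m, ∀ w ∈ W R (m + 2), ∃ c : k, w = c • TensorAlgebra.ι k u ^ (m + 2) := by
    intro m
    induction m with
    | zero =>
      intro w hw
      obtain ⟨c, rfl⟩ := exists_smul_of_mem_W_two hw
      exact ⟨c, by rw [zero_add, pow_two]⟩
    | succ m ih =>
      intro w hw
      obtain ⟨t, rfl⟩ := exists_eq_of_mem_W hw
      obtain ⟨c, hc⟩ := ih _ (mem_of_ι_mul_mem_W hu hw)
      exact ⟨c, by rw [hc, mul_smul_comm, ← pow_succ']⟩
  let w : ∀ m, W R m := fun m => ⟨_, hmem m⟩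
  have hw₀ : ∀ m, w m ≠ 0 := fun m h => by
    have h' : TensorAlgebra.ι k u ^ m = 0 := congrArg Subtype.val h
    clear h
    induction m with
    | zero => exact one_ne_zero ((pow_zero _).symm.trans h')
    | succ m ih => exact ih (ι_mul_injective hu (by rwa [← pow_succ']))
  have hD : ∀ m a, koszulD R m (a ⊗ₜ w (m + 1)) = (a * gen R u) ⊗ₜ w m := fun m a =>
    koszulD_tmul R m a (pow_succ' _ _)
  have hz : ∀ m, ∀ z : QuadraticAlgebra R ⊗[k] W R (m + 2), ∃ a, z = a ⊗ₜ w (m + 2) := fun m z =>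
    exists_eq_tmul_of_forall_eq_smul (fun y => by
      obtain ⟨c, hc⟩ := hspan m _ y.2
      exact ⟨c, Subtype.ext hc⟩) z
  rintro (_ | i)
  · exact exact_koszulD_zero
  · intro z
    constructor
    · intro h
      obtain ⟨a, rfl⟩ := hz _ z
      rw [hD] at h
      obtain ⟨b, rfl⟩ := (isPresentation_gen (k := k) u u).exists_eq_mul hu
        (eq_zero_of_tmul_eq_zero (hw₀ _) h)
      exact ⟨b ⊗ₜ w _, hD _ b⟩
    · rintro ⟨y, rfl⟩
      obtain ⟨a, rfl⟩ := hz _ y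
      rw [hD, hD, mul_assoc, gen_mul_gen_eq_zero (hR ▸ Submodule.mem_span_singleton_self _),
        mul_zero, zero_tmul]

end Koszul

/-! ### Projective dimensions and `Ext²(k, A)` -/

section Homological

open CategoryTheory CategoryTheory.Abelian

universe u v w

/-- In a projective resolution of length two, a morphism `P₂ ⟶ Y` whose class in `Ext²` vanishes
extends to `P₁`. -/
theorem exists_comp_eq_of_extClass_comp_eq_zero {C : Type*} [Category C] [Abelian C] [HasExt.{w} C]
    {P₂ P₁ K P₀ M Y : C} {d₂ : P₂ ⟶ P₁} {d₁ : P₁ ⟶ K} {i : K ⟶ P₀} {d₀ : P₀ ⟶ M}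
    {w₂ : d₂ ≫ d₁ = 0} {w₁ : i ≫ d₀ = 0} (h₂ : (ShortComplex.mk d₂ d₁ w₂).ShortExact)
    (h₁ : (ShortComplex.mk i d₀ w₁).ShortExact) [Projective P₀] (g : P₂ ⟶ Y)
    (hg : h₁.extClass.comp (h₂.extClass.comp (Ext.mk₀ g) (add_zero 1)) (one_add_one_eq_two) = 0) :
    ∃ ψ : P₁ ⟶ Y, d₂ ≫ ψ = g := by
  obtain ⟨x, hx⟩ := Ext.contravariant_sequence_exact₁ h₁ _ _ _ hg
  -- `Ext¹(P₀, Y) = 0`, so connecting by `h₁` loses nothing; the second sequence then gives the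
  -- extension to `P₁`.
  have hx₀ : x = 0 := Ext.eq_zero_of_projective (P := P₀) x
  rw [hx₀, Ext.comp_zero] at hx
  obtain ⟨y, hy⟩ := Ext.contravariant_sequence_exact₁ h₂ _ _ _ hx.symm
  obtain ⟨ψ, rfl⟩ := Ext.homEquiv₀.symm.surjective y
  refine ⟨ψ, Ext.homEquiv₀.symm.injective ?_⟩
  simpa using hy

variable {k : Type u} [Field k] {V : Type v} [AddCommGroup V] [Module k V]
  {A : Type (max u v)} [Ring A] [Algebra k A] {γ : V →ₗ[k] A} {a b : V}

open ModuleCat in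
theorem IsPresentation.shortExact_res (h : IsPresentation γ a b) {φ ψ : V →ₗ[k] k}
    (ha : φ a ≠ 0) (hb : φ b = 0) (ha' : ψ a = 0) (hb' : ψ b = 1)
    (M : Type (max u v)) [AddCommGroup M] [Module k M] [Module A M] [IsScalarTower k A M] :
    ∃ (d₁ : A ⊗[k] (V ⊗[k] M) →ₗ[A] (resD0 (k := k) A M).ker)
      (h₁ : d₁ ∘ₗ resD2 γ a b M = 0),
      (ModuleCat.shortComplexOfCompEqZero.{_, max u v} (R := A) (M := A ⊗[k] M)
        (N := A ⊗[k] (V ⊗[k] M)) (L := (resD0 (k := k) A M).ker)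
        (resD2 γ a b M) d₁ h₁).ShortExact := by
  have hex := h.exact_resD1_resD0 M
  have hex' := h.exact_resD2_resD1 M
  refine ⟨(resD1 γ M).codRestrict _ hex.apply_apply_eq_zero, ?_, ?_⟩
  · exact LinearMap.ext fun z => Subtype.ext (hex'.apply_apply_eq_zero z)
  · refine ModuleCat.shortComplex_shortExact _ ?_ (h.resD2_injective M ha hb ha' hb') ?_
    · intro z
      exact Subtype.ext_iff.trans (hex' z)
    · rintro ⟨z, hz⟩
      obtain ⟨w, rfl⟩ := (hex z).1 hz
      exact ⟨w, rfl⟩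

-- Dimension shifting twice along the resolution, whose terms `A ⊗ X` are all free.
open scoped ModuleCat in
theorem IsPresentation.hasProjectiveDimensionLT_three (h : IsPresentation γ a b)
    {φ ψ : V →ₗ[k] k} (ha : φ a ≠ 0) (hb : φ b = 0) (ha' : ψ a = 0) (hb' : ψ b = 1)
    (M : ModuleCat.{max u v} A) : HasProjectiveDimensionLT M 3 := by
  obtain ⟨d₁, h₁, hS⟩ := h.shortExact_res ha hb ha' hb' M
  have hS₀ := LinearMap.shortExact_shortComplexKer (resD0_surjective (k := k) (A := A) M)
  have p₀ : Projective (ModuleCat.of A (A ⊗[k] M)) :=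
    (IsProjective.iff_projective _).1 inferInstance
  have p₁ : Projective (ModuleCat.of A (A ⊗[k] (V ⊗[k] M))) :=
    (IsProjective.iff_projective _).1 inferInstance
  exact (hS₀.hasProjectiveDimensionLT_X₃_iff 1 p₀).2
    ((hS.hasProjectiveDimensionLT_X₃_iff 0 p₁).2
      (inferInstanceAs (HasProjectiveDimensionLT (ModuleCat.of A (A ⊗[k] M)) 1)))

/-- There is a class in `Ext²(k, A)` which is not killed by the generator `b`. -/
theorem IsPresentation.exists_ext_comp_ne_zero [HasExt.{w} (ModuleCat.{max u v} A)]
    (h : IsPresentation γ a b)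
    {φ ψ : V →ₗ[k] k} (ha : φ a ≠ 0) (hb : φ b = 0) (ha' : ψ a = 0) (hb' : ψ b = 1)
    (M : Type (max u v)) [AddCommGroup M] [Module k M] [Module A M] [IsScalarTower k A M]
    (hM : ∀ (m : M), γ b • m = 0) (θ : M →ₗ[k] k) {m₀ : M} (hm₀ : θ m₀ = 1) :
    ∃ e : Ext (ModuleCat.of A M) (ModuleCat.of A A) 2,
      e.comp (Ext.mk₀ (ModuleCat.ofHom (LinearMap.toSpanSingleton A A (γ b)))) (add_zero 2) ≠ 0 := by
  obtain ⟨d₁, h₁, hS⟩ := h.shortExact_res ha hb ha' hb' M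
  have hS₀ := LinearMap.shortExact_shortComplexKer (resD0_surjective (k := k) (A := A) M)
  have p₀ : Projective (ModuleCat.of A (A ⊗[k] M)) :=
    (IsProjective.iff_projective _).1 inferInstance
  let g : A ⊗[k] M →ₗ[A] A := freeLift (Algebra.linearMap k A ∘ₗ θ)
  refine ⟨hS₀.extClass.comp (hS.extClass.comp (Ext.mk₀ (ModuleCat.ofHom g)) (add_zero 1))
    one_add_one_eq_two, fun he => ?_⟩
  rw [Ext.comp_assoc_of_third_deg_zero, Ext.comp_assoc_of_third_deg_zero, Ext.mk₀_comp_mk₀] at he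
  obtain ⟨χ, hχ⟩ := exists_comp_eq_of_extClass_comp_eq_zero hS hS₀ _ he
  -- As `b` kills `M`, evaluation at `1 ⊗ m₀` reads `a · χ(1 ⊗ b ⊗ m₀) = b` in `A`. This forces `b`
  -- to be proportional to `a`, against `ψ`.
  have h' := congrArg (fun f => f.hom (1 ⊗ₜ[k] m₀)) hχ
  have h'' : χ.hom (resD2 γ a b M (1 ⊗ₜ m₀)) = g (1 ⊗ₜ m₀) • γ b := h'
  have hg : g (1 ⊗ₜ m₀) = 1 := by simp [g, hm₀]
  rw [hg, one_smul, resD2_tmul, hM, tmul_zero, tmul_zero, add_zero, one_mul] at h''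
  have h₃ : γ a ⊗ₜ[k] (b ⊗ₜ[k] m₀) = γ a • ((1 : A) ⊗ₜ[k] (b ⊗ₜ[k] m₀)) := by
    rw [smul_tmul', smul_eq_mul, mul_one]
  rw [h₃, map_smul] at h''
  obtain ⟨c, hc⟩ := Submodule.mem_span_singleton.1 (h.mem_span_of_eq_mul h''.symm)
  rw [← hc, map_smul, ha', smul_zero] at hb'
  exact zero_ne_one hb'

/-- The left ideal generated by `a`, in the algebra with the relation `a ^ 2 = 0`. -/
theorem IsPresentation.projectiveDimension_span_eq_top (h : IsPresentation γ a a) (ha : a ≠ 0) :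
    projectiveDimension (ModuleCat.of A (Submodule.span A {γ a})) = ⊤ := by
  let N := Submodule.span A {γ a}
  let y : N := ⟨γ a, Submodule.mem_span_singleton_self _⟩
  let f : A →ₗ[A] N := LinearMap.toSpanSingleton A N y
  have hf : Function.Surjective f := fun ⟨x, hx⟩ => by
    obtain ⟨c, rfl⟩ := Submodule.mem_span_singleton.1 hx
    exact ⟨c, rfl⟩
  have hfN : ∀ x, f x = 0 ↔ x ∈ N := fun x => by
    have : f x = 0 ↔ x * γ a = 0 := Subtype.ext_iff
    rw [this]
    constructor
    · intro hx
      obtain ⟨c, rfl⟩ := h.exists_eq_mul ha hx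
      exact Submodule.mem_span_singleton.2 ⟨c, rfl⟩
    · intro hx
      obtain ⟨c, rfl⟩ := Submodule.mem_span_singleton.1 hx
      rw [smul_eq_mul, mul_assoc, h.mul_eq_zero, mul_zero]
  have hS : (ModuleCat.shortComplexOfCompEqZero N.subtype f
      (LinearMap.ext fun x => (hfN _).2 x.2)).ShortExact :=
    ModuleCat.shortComplex_shortExact _ (fun x => (hfN x).trans (by simp))
      N.injective_subtype hf
  have p : Projective (ModuleCat.of A A) := (IsProjective.iff_projective _).1 inferInstance
  by_contra hd
  obtain ⟨n, hn⟩ := (projectiveDimension_ne_top_iff _).1 hd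
  -- In `0 → N → A → N → 0` the module `N` is its own syzygy, so any finite bound descends until `N`
  -- is projective.
  have h₁ : HasProjectiveDimensionLT (ModuleCat.of A N) 1 := by
    induction n with
    | zero => exact hn
    | succ n ih => exact ih ((hS.hasProjectiveDimensionLT_X₃_iff n p).1 hn)
  have : Module.Projective A N :=
    (IsProjective.iff_projective _).2 (projective_iff_hasProjectiveDimensionLT_one.2 h₁)
  -- A section `s` would give an element `s y` of `A` with `s(y) a = a` and `a s(y) = s(a y) = 0`.
  obtain ⟨s, hs⟩ := Module.projective_lifting_property f LinearMap.id hf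
  refine ha (h.eq_zero_of_mul_eq_self (a := s y) ?_ ?_)
  · exact congrArg Subtype.val (LinearMap.congr_fun hs y)
  · rw [← smul_eq_mul, ← map_smul]
    have : γ a • y = 0 := Subtype.ext h.mul_eq_zero
    rw [this, map_zero]

end Homological

/-! ### Rank one tensors, symmetry and (P2) -/

section Rank

variable {k : Type*} [Field k] {V : Type*} [AddCommGroup V] [Module k V] {n : ℕ}

theorem coeffMatrix_tmul (b : Module.Basis (Fin n) k V) (u v : V) (i j : Fin n) :
    coeffMatrix b (u ⊗ₜ v) i j = b.repr u i * b.repr v j := by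
  simp [coeffMatrix, mul_comm]

theorem coeffMatrix_injective (b : Module.Basis (Fin n) k V) :
    Function.Injective (coeffMatrix b) := fun f g h => by
  apply (b.tensorProduct b).repr.injective
  ext ⟨i, j⟩
  exact congrFun (congrFun h i) j

/-- A tensor of rank one is a non-zero pure tensor. -/
theorem exists_eq_tmul_of_rank_eq_one (b : Module.Basis (Fin n) k V) {f : V ⊗[k] V}
    (hf : (coeffMatrix b f).rank = 1) : ∃ u v : V, u ≠ 0 ∧ v ≠ 0 ∧ f = u ⊗ₜ v := by
  have hf₀ : f ≠ 0 := by
    rintro rfl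
    have : coeffMatrix b (0 : V ⊗[k] V) = 0 := by ext; simp [coeffMatrix]
    rw [this, Matrix.rank_zero] at hf
    exact zero_ne_one hf
  rw [Matrix.rank_eq_finrank_span_cols] at hf
  obtain ⟨⟨w, _⟩, _, hw⟩ := finrank_eq_one_iff'.1 hf
  have hc : ∀ j, ∃ c : k, c • w = (coeffMatrix b f).col j := fun j => by
    obtain ⟨c, hc⟩ := hw ⟨_, Submodule.subset_span ⟨j, rfl⟩⟩
    exact ⟨c, congrArg Subtype.val hc⟩
  choose c hc using hc
  -- The column space is the line of `w`, and the `j`-th column is `c j • w`.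
  have h : f = b.equivFun.symm w ⊗ₜ b.equivFun.symm c := by
    apply coeffMatrix_injective b
    ext i j
    rw [coeffMatrix_tmul, ← b.equivFun_apply, ← b.equivFun_apply, LinearEquiv.apply_symm_apply,
      LinearEquiv.apply_symm_apply, mul_comm]
    exact (congrFun (hc j) i).symm
  refine ⟨_, _, fun hu => hf₀ ?_, fun hv => hf₀ ?_, h⟩
  · rw [h, hu, zero_tmul]
  · rw [h, hv, tmul_zero]

theorem PropertyP2.isSymmetricTensor {f : V ⊗[k] V} (h : PropertyP2 f) : IsSymmetricTensor f := by
  obtain ⟨n, b, i, -, hi⟩ := h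
  have hf : f = coeffMatrix b f i i • (b i ⊗ₜ b i) := by
    apply coeffMatrix_injective b
    ext p q
    rw [smul_tmul', coeffMatrix_tmul]
    by_cases hpq : (p, q) = (i, i)
    · obtain ⟨rfl, rfl⟩ := Prod.mk.inj hpq
      simp
    · rw [hi p q hpq]
      rcases not_and_or.1 (fun h => hpq (Prod.ext h.1 h.2)) with h | h
      · simp [Finsupp.single_apply, Ne.symm h]
      · simp [Finsupp.single_apply, Ne.symm h]
  rw [IsSymmetricTensor, hf, map_smul, comm_tmul]

/-- Applying `φ` to the first factor of `v ⊗ u = u ⊗ v` gives `φ(v) u = φ(u) v`. -/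
theorem mem_span_of_isSymmetricTensor {u v : V} (hu : u ≠ 0)
    (h : IsSymmetricTensor (u ⊗ₜ[k] v)) : v ∈ Submodule.span k {u} := by
  obtain ⟨φ, hφ⟩ := Module.Projective.exists_dual_ne_zero (R := k) hu
  have h' := congrArg (TensorProduct.lid k V ∘ LinearMap.rTensor V φ) h
  simp only [Function.comp_apply, comm_tmul, LinearMap.rTensor_tmul, lid_tmul] at h'
  refine Submodule.mem_span_singleton.2 ⟨(φ u)⁻¹ * φ v, ?_⟩
  rw [mul_smul, h', smul_smul, inv_mul_cancel₀ hφ, one_smul]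

theorem propertyP2_smul_basis (b : Module.Basis (Fin n) k V) (i : Fin n) {c : k} (hc : c ≠ 0) :
    PropertyP2 (c • (b i ⊗ₜ[k] b i)) := by
  refine ⟨_, b, i, ?_, fun p q hpq => ?_⟩
  · rw [smul_tmul', coeffMatrix_tmul]
    simpa using hc
  · rw [smul_tmul', coeffMatrix_tmul]
    by_cases hp : i = p
    · have hq : i ≠ q := fun hq => hpq (by rw [← hp, ← hq])
      simp [Finsupp.single_apply, hq]
    · simp [Finsupp.single_apply, hp]

theorem propertyP2_smul [FiniteDimensional k V] {u : V} (hu : u ≠ 0) {c : k} (hc : c ≠ 0) :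
    PropertyP2 (c • (u ⊗ₜ[k] u)) := by
  have hli : LinearIndepOn k id {u} := LinearIndepOn.singleton hu
  let b := Module.Basis.extend hli
  have : Finite (hli.extend (Set.subset_univ _)) := Module.Finite.finite_basis b
  have := Fintype.ofFinite (hli.extend (Set.subset_univ _))
  let e := Fintype.equivFin (hli.extend (Set.subset_univ _))
  let i := e ⟨u, hli.subset_extend _ rfl⟩
  have hi : b.reindex e i = u := by simp [b, i]
  have h := propertyP2_smul_basis (b.reindex e) i hc
  rwa [hi] at h

end Rank

/-! ### Global dimension and failure of the AS-Gorenstein property -/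

section GlobalDimension

open CategoryTheory CategoryTheory.Abelian

universe u v

variable {k : Type u} [Field k] {V : Type v} [AddCommGroup V] [Module k V] {a b : V}

theorem globalDimension_sq (ha : a ≠ 0) :
    globalDimension (QuadraticAlgebra (Submodule.span k {a ⊗ₜ[k] a})) = ⊤ :=
  top_le_iff.1 (((isPresentation_gen (k := k) a a).projectiveDimension_span_eq_top ha).ge.trans
    (le_iSup (fun M : ModuleCat.{max u v} (QuadraticAlgebra (Submodule.span k {a ⊗ₜ[k] a})) =>
      projectiveDimension M) _))

section

variable {φ ψ : V →ₗ[k] k} (ha : φ a ≠ 0) (hb : φ b = 0) (ha' : ψ a = 0) (hb' : ψ b = 1)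

include ha hb ha' hb'

open scoped ModuleCat in
theorem exists_extAct_ne_zero :
    ∃ e : Ext (trivialModule (Submodule.span k {a ⊗ₜ[k] b}))
      (regularModule (Submodule.span k {a ⊗ₜ[k] b})) 2, extAct _ e (gen _ b) ≠ 0 := by
  let R := Submodule.span k {a ⊗ₜ[k] b}
  have hsmul : ∀ (c : QuadraticAlgebra R) (m : trivialModule R),
      (ULift.down (c • m : trivialModule R) : k) = augmentation R c * ULift.down m := fun c m => rfl
  let θ : trivialModule R →ₗ[k] k :=
    { toFun := fun m => ULift.down m
      map_add' := fun _ _ => rfl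
      map_smul' := fun c m => by
        rw [← algebraMap_smul (QuadraticAlgebra R) c m, hsmul, AlgHom.commutes]
        rfl }
  refine (isPresentation_gen (k := k) a b).exists_ext_comp_ne_zero ha hb ha' hb'
    (trivialModule R) (fun m => ?_) θ (m₀ := ULift.up 1) rfl
  exact ULift.down_injective ((hsmul _ m).trans (by rw [augmentation_gen, zero_mul]; rfl))

theorem globalDimension_eq_two :
    globalDimension (QuadraticAlgebra (Submodule.span k {a ⊗ₜ[k] b})) = 2 := by
  refine le_antisymm (iSup_le fun M => ?_) ?_
  · exact (projectiveDimension_le_iff M 2).2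
      ((isPresentation_gen a b).hasProjectiveDimensionLT_three ha hb ha' hb' M)
  · refine le_trans ?_ (le_iSup (fun M : ModuleCat.{max u v}
      (QuadraticAlgebra (Submodule.span k {a ⊗ₜ[k] b})) => projectiveDimension M)
        (trivialModule _))
    refine (projectiveDimension_ge_iff _ 2).2 fun h => ?_
    obtain ⟨e, he⟩ := exists_extAct_ne_zero ha hb ha' hb'
    exact he (Ext.eq_zero_of_hasProjectiveDimensionLT _ 2 le_rfl)

/-- The global dimension forces `d = 2`, and generators act by zero on the trivial module, whereas
`b` acts nontrivially on `Ext²(k, A)`. -/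
theorem not_isASGorenstein_of_dual : ¬ IsASGorenstein (Submodule.span k {a ⊗ₜ[k] b}) := by
  rintro ⟨d, -, hd, -, e, he⟩
  rw [globalDimension_eq_two ha hb ha' hb'] at hd
  obtain rfl : 2 = d := by exact_mod_cast hd
  obtain ⟨x, hx⟩ := exists_extAct_ne_zero ha hb ha' hb'
  refine hx (e.injective ?_)
  rw [he, augmentation_gen, mul_zero, map_zero]

end

theorem exists_dual_of_notMem_span (hb : b ∉ Submodule.span k {a}) :
    ∃ ψ : V →ₗ[k] k, ψ a = 0 ∧ ψ b = 1 := by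
  obtain ⟨ψ, hψ, h⟩ := Submodule.exists_le_ker_of_notMem hb
  refine ⟨(ψ b)⁻¹ • ψ, ?_, ?_⟩
  · rw [LinearMap.smul_apply, h (Submodule.mem_span_singleton_self a), smul_zero]
  · rw [LinearMap.smul_apply, smul_eq_mul, inv_mul_cancel₀ hψ]

end GlobalDimension

end QuadAlg

theorem mainTheorem7 {k : Type*} [Field k] {V : Type*} [AddCommGroup V] [Module k V]
    {n : ℕ} (x : Module.Basis (Fin n) k V) (f : TensorProduct k V V)
    (hf : (QuadAlg.coeffMatrix x f).rank = 1) :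
    QuadAlg.IsKoszul (Submodule.span k {f}) ∧
    (QuadAlg.globalDimension (QuadAlg.QuadraticAlgebra (Submodule.span k {f})) = 2 ∨
      QuadAlg.globalDimension (QuadAlg.QuadraticAlgebra (Submodule.span k {f})) = ⊤) ∧
    (QuadAlg.globalDimension (QuadAlg.QuadraticAlgebra (Submodule.span k {f})) = ⊤ ↔
      QuadAlg.PropertyP2 f) ∧
    (QuadAlg.PropertyP2 f ↔ QuadAlg.IsSymmetricTensor f) ∧
    ¬ QuadAlg.IsASGorenstein (Submodule.span k {f}) := by
  have : FiniteDimensional k V := Module.Finite.of_basis x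
  obtain ⟨u, v, hu, hv, rfl⟩ := QuadAlg.exists_eq_tmul_of_rank_eq_one x hf
  by_cases huv : v ∈ Submodule.span k {u}
  · obtain ⟨c, rfl⟩ := Submodule.mem_span_singleton.1 huv
    have hc : c ≠ 0 := fun h => hv (by rw [h, zero_smul])
    have hspan : Submodule.span k {u ⊗ₜ[k] (c • u)} = Submodule.span k {u ⊗ₜ[k] u} := by
      rw [tmul_smul]
      exact Submodule.span_singleton_smul_eq (IsUnit.mk0 c hc) _
    have hP : QuadAlg.PropertyP2 (u ⊗ₜ[k] (c • u)) := by
      rw [tmul_smul]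
      exact QuadAlg.propertyP2_smul hu hc
    have hgl := QuadAlg.globalDimension_sq (k := k) hu
    rw [hspan]
    refine ⟨QuadAlg.isKoszul_sq hu, Or.inr hgl, iff_of_true hgl hP,
      iff_of_true hP hP.isSymmetricTensor, ?_⟩
    rintro ⟨d, -, hd, -⟩
    rw [hgl] at hd
    exact absurd hd (by rintro ⟨⟩)
  · have huv' : u ∉ Submodule.span k {v} := fun h => by
      obtain ⟨c, rfl⟩ := Submodule.mem_span_singleton.1 h
      have hc : c ≠ 0 := fun h => hu (by rw [h, zero_smul])
      exact huv (Submodule.mem_span_singleton.2 ⟨c⁻¹, inv_smul_smul₀ hc v⟩)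
    obtain ⟨ψ, hψu, hψv⟩ := QuadAlg.exists_dual_of_notMem_span huv
    obtain ⟨φ, hφv, hφu⟩ := QuadAlg.exists_dual_of_notMem_span huv'
    have hφu₀ : φ u ≠ 0 := by rw [hφu]; exact one_ne_zero
    have hsym : ¬ QuadAlg.IsSymmetricTensor (u ⊗ₜ[k] v) := fun h =>
      huv (QuadAlg.mem_span_of_isSymmetricTensor hu h)
    have hP : ¬ QuadAlg.PropertyP2 (u ⊗ₜ[k] v) := fun h => hsym h.isSymmetricTensor
    have hgl := QuadAlg.globalDimension_eq_two hφu₀ hφv hψu hψv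
    refine ⟨QuadAlg.isKoszul_of_dual hφu₀ hφv hψu hψv, Or.inl hgl,
      iff_of_false (fun h => ?_) hP, iff_of_false hP hsym,
      QuadAlg.not_isASGorenstein_of_dual hφu₀ hφv hψu hψv⟩
    rw [hgl] at h
    exact absurd h (by rintro ⟨⟩)
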